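/- **Proposition (classical solution, real potential of any sign).** Let $G$ be a graded Lie group, i.e. a connected, simply connected real Lie group whose Lie algebra has a decomposition $\mathfrak g=\bigoplus_{i\ge 1}\mathfrak g_i$ with $[\mathfrak g_i,\mathfrak g_j]\subset\mathfrak g_{i+j}$, equipped with a Haar measure. Let $X_1,\dots,X_n$ be a basis of $\mathfrak g$ with $X_j\in\mathfrak g_{\nu_j}$, and let $\mathcal R=\sum_{[\alpha]=\nu}c_\alpha X_1^{\alpha_1}\cdots X_n^{\alpha_n}$ (with $[\alpha]=\sum_j\nu_j\alpha_j$, $c_\alpha\in\mathbb C$) be a positive Rockland operator of homogeneous degree $\nu>0$, that is, $\langle\mathcal R\varphi,\varphi\rangle_{L^2(G)}\ge 0$ for all $\varphi\in C_c^\infty(G)$, and for every nontrivial irreducible unitary representation $\pi$ of $G$ the operator $\pi(\mathcal R)$ is injective on the smooth vectors of $\pi$. Denote again by $\mathcal R$ its positive self-adjoint (Friedrichs) extension on $L^2(G)$: $\mathcal Rf=g$ iff $f,g\in L^2(G)$, $\mathcal Rf=g$ in the sense of distributions, and $f\in H^{\nu/2}(G)$, the completion of $C_c^\infty(G)$ in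 the norm $\|\varphi\|_{L^2}+\langle\mathcal R\varphi,\varphi\rangle^{1/2}$. Let $T>0$, let $V\in L^\infty(G)$ be real-valued and let $u_0\in L^2(G)$. Consider the Cauchy problem $$u_t+\mathcal Ru+Vu=0 \ \text{ on } [0,T]\times G,\qquad u(0,\cdot)=u_0 .$$ Call $u\in C([0,T];L^2(G))$ with $u(0)=u_0$ a *classical solution* if $u\in C^1((0,T];L^2(G))$ and, for all $t\in(0,T]$, $u(t)\in\mathrm{Dom}(\mathcal R)$ and $u'(t)+\mathcal Ru(t)+Vu(t)=0$ in $L^2(G)$; call it a *weak solution* if $\frac{d}{dt}\langle w,u(t)\rangle=-\langle\mathcal Rw,u(t)\rangle-\langle w,Vu(t)\rangle$ on $[0,T]$ for all $w\in\mathrm{Dom}(\mathcal R)$. Then there is a unique solution $u\in C([0,T];L^2(G))$: there is a $u$ that is both a classical and a weak solution, and every classical or weak solution coincides with $u$ on $[0,T]$. It satisfies $$\|u(t,\cdot)\|_{L^2(G)}\le \exp\!\big(t\,\|V\|_{L^\infty(G)}\big)\,\|u_0\|_{L^2(G)}\qquad\text{for all } t\in[0,T].$$ -/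

import Mathlib

open MeasureTheory Set Filter Topology
open scoped Manifold ContDiff ENNReal ComplexConjugate

noncomputable section

namespace RocklandHeat

/-! ### Graded Lie groups -/

/-- A grading `𝔤 = ⨁_{i ≥ 1} 𝔤ᵢ` of the Lie algebra of `G`, with `[𝔤ᵢ, 𝔤ⱼ] ⊆ 𝔤ᵢ₊ⱼ`.
As `𝔤` is finite-dimensional, all but finitely many of the `𝔤ᵢ` are zero. -/
structure LieGrading (E : Type*) [NormedAddCommGroup E] [NormedSpace ℝ E]
    (G : Type*) [TopologicalSpace G] [ChartedSpace E G] [Group G] where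
  /-- The layers `𝔤ᵢ`. -/
  layer : ℕ → Submodule ℝ (GroupLieAlgebra 𝓘(ℝ, E) G)
  layer_zero : layer 0 = ⊥
  isInternal : DirectSum.IsInternal layer
  bracket_mem : ∀ (i j : ℕ) (x y : GroupLieAlgebra 𝓘(ℝ, E) G),
    x ∈ layer i → y ∈ layer j → ⁅x, y⁆ ∈ layer (i + j)

/-- The ordered monomial `X₁^{α₁} ∘ ⋯ ∘ Xₙ^{αₙ}` in the operators `X₁, …, Xₙ` on `M`. -/
def orderedMonomial {M : Type*} {n : ℕ} (X : Fin n → M → M) (α : Fin n → ℕ) (m : M) : M :=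
  (List.finRange n).foldr (fun j x => (X j)^[α j] x) m

section Operators

variable {E : Type*} [NormedAddCommGroup E] [NormedSpace ℝ E]
  {G : Type*} [TopologicalSpace G] [ChartedSpace E G] [Group G]

/-- The derivative of `f : G → ℂ` along the left-invariant vector field with value `v` at `1`:
`(v f)(x) = d/dt f (x exp (t v))` at `t = 0`. -/
def leftInvDeriv (v : GroupLieAlgebra 𝓘(ℝ, E) G) (f : G → ℂ) (x : G) : ℂ :=
  mfderiv 𝓘(ℝ, E) 𝓘(ℝ, ℂ) f x (mulInvariantVectorField v x)

variable (E G) in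
/-- A left-invariant differential operator `∑_{[α] = ν} c_α X^α` which is homogeneous of positive
degree `ν`. Here `X₁, …, Xₙ` is a basis of `𝔤` with `Xⱼ` in the layer of index `νⱼ`,
and `[α] = ν₁ α₁ + ⋯ + νₙ αₙ`. -/
structure HomogeneousOperator (gr : LieGrading E G) where
  /-- The dimension of `G`. -/
  n : ℕ
  /-- The basis `X₁, …, Xₙ`. -/
  basis : Module.Basis (Fin n) ℝ (GroupLieAlgebra 𝓘(ℝ, E) G)
  /-- The dilation weights `ν₁, …, νₙ`. -/
  weight : Fin n → ℕ
  basis_mem : ∀ j, basis j ∈ gr.layer (weight j)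
  /-- The coefficients `c_α`. -/
  coeff : (Fin n → ℕ) →₀ ℂ
  /-- The homogeneous degree `ν`. -/
  degree : ℕ
  degree_pos : 0 < degree
  homogeneous : ∀ α ∈ coeff.support, ∑ j, weight j * α j = degree

variable {gr : LieGrading E G}

/-- The action `R φ = ∑ c_α X^α φ` of the differential operator on (smooth) functions. -/
def HomogeneousOperator.apply (R : HomogeneousOperator E G gr) (φ : G → ℂ) : G → ℂ :=
  ∑ α ∈ R.coeff.support, R.coeff α • orderedMonomial (fun j => leftInvDeriv (R.basis j)) α φ

/-- The test functions `𝒟(G)`: smooth compactly supported functions `G → ℂ`. -/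
def IsTestFunction (E : Type*) [NormedAddCommGroup E] [NormedSpace ℝ E]
    {G : Type*} [TopologicalSpace G] [ChartedSpace E G] (φ : G → ℂ) : Prop :=
  ContMDiff 𝓘(ℝ, E) 𝓘(ℝ, ℂ) ∞ φ ∧ HasCompactSupport φ

/-! ### The Rockland condition -/

section Representations

variable {H : Type*} [NormedAddCommGroup H] [InnerProductSpace ℂ H] [CompleteSpace H]

/-- `π` is a strongly continuous irreducible unitary representation of `G`. -/
def IsIrreducibleUnitaryRep (π : G →* unitary (H →L[ℂ] H)) : Prop :=
  (∀ v : H, Continuous fun g : G => (π g : H →L[ℂ] H) v) ∧ Nontrivial H ∧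
    ∀ W : Submodule ℂ H, IsClosed (W : Set H) →
      (∀ (g : G), ∀ w ∈ W, (π g : H →L[ℂ] H) w ∈ W) → W = ⊥ ∨ W = ⊤

variable (E) in
/-- `v` is a smooth vector of `π`: the orbit map `g ↦ π(g) v` is smooth. -/
def IsSmoothVector (π : G →* unitary (H →L[ℂ] H)) (v : H) : Prop :=
  ContMDiff 𝓘(ℝ, E) 𝓘(ℝ, H) ∞ fun g : G => (π g : H →L[ℂ] H) v

/-- The infinitesimal representation `π(X) v = d/dt π(exp (t X)) v` at `t = 0`
(on smooth vectors `v`). -/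
def infinitesimalRep (π : G →* unitary (H →L[ℂ] H)) (X : GroupLieAlgebra 𝓘(ℝ, E) G) (v : H) : H :=
  mfderiv 𝓘(ℝ, E) 𝓘(ℝ, H) (fun g : G => (π g : H →L[ℂ] H) v) 1 X

/-- `π(R) = ∑ c_α π(X)^α` (on smooth vectors). -/
def HomogeneousOperator.rep (R : HomogeneousOperator E G gr)
    (π : G →* unitary (H →L[ℂ] H)) (v : H) : H :=
  ∑ α ∈ R.coeff.support,
    R.coeff α • orderedMonomial (fun j => infinitesimalRep π (R.basis j)) α v

end Representations

/-- The Rockland condition: for every nontrivial irreducible unitary representation `π` of `G`,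
the operator `π(R)` is injective on the smooth vectors. (Such representations act on separable
Hilbert spaces, so that all of them occur, up to equivalence, on Hilbert spaces in `Type`.) -/
def HomogeneousOperator.IsRockland (R : HomogeneousOperator E G gr) : Prop :=
  ∀ (H : Type) [NormedAddCommGroup H] [InnerProductSpace ℂ H] [CompleteSpace H]
    (π : G →* unitary (H →L[ℂ] H)), IsIrreducibleUnitaryRep π → (∃ g, π g ≠ 1) →
    ∀ v : H, IsSmoothVector E π v → R.rep π v = 0 → v = 0

variable [MeasurableSpace G] (μ : Measure G)

/-- `R` is a positive operator: `⟨R φ, φ⟩` is real and nonnegative for all test functions `φ`. -/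
def HomogeneousOperator.IsPositive (R : HomogeneousOperator E G gr) : Prop :=
  ∀ φ : G → ℂ, IsTestFunction E φ →
    0 ≤ (∫ x, R.apply φ x * conj (φ x) ∂μ).re ∧ (∫ x, R.apply φ x * conj (φ x) ∂μ).im = 0

variable {μ}

/-- The Sobolev space `H^{ν/2}(G)`, the domain of `√R`, inside `L²(G)`: the completion of the test
functions for `‖φ‖_{L²} + ‖√R φ‖_{L²}`, where `‖√R φ‖² = ⟨R φ, φ⟩`. Concretely, `f` is the
`L²`-limit of test functions `φ₀, φ₁, …` with `‖√R (φ_k - φ_l)‖ → 0` as `k, l → ∞`. -/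
def HomogeneousOperator.MemSobolev (R : HomogeneousOperator E G gr) (f : Lp ℂ 2 μ) : Prop :=
  ∃ φ : ℕ → G → ℂ, (∀ k, IsTestFunction E (φ k)) ∧
    Tendsto (fun k => eLpNorm (fun x => φ k x - f x) 2 μ) atTop (𝓝 0) ∧
    Tendsto (fun p : ℕ × ℕ => (∫ x, R.apply (fun y => φ p.1 y - φ p.2 y) x *
      conj (φ p.1 x - φ p.2 x) ∂μ).re) atTop (𝓝 0)

/-- The graph of the positive self-adjoint extension of `R` to `L²(G)` (the Friedrichs extension):
`f` lies in its domain and it maps `f` to `g ∈ L²(G)` iff `f ∈ H^{ν/2}(G)` and `R f = g` in the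
sense of distributions, i.e. `⟨R φ, f⟩ = ⟨φ, g⟩` for all test functions `φ`
(a positive `R` is formally self-adjoint). -/
def HomogeneousOperator.HasValue (R : HomogeneousOperator E G gr) (f g : Lp ℂ 2 μ) : Prop :=
  R.MemSobolev f ∧ ∀ φ : G → ℂ, IsTestFunction E φ →
    ∫ x, conj (R.apply φ x) * f x ∂μ = ∫ x, conj (φ x) * g x ∂μ

/-! ### Solutions of the Cauchy problem `u_t + R u + V u = 0`, `u(0) = u₀` -/

/-- Classical solutions on `[0, T]`: `u ∈ C([0,T]; L²) ∩ C¹((0,T]; L²)` with `u(0) = u₀`, such that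
for all `t ∈ (0, T]`, `u(t)` is in the domain of `R` and `R u(t) = - u'(t) - V u(t)`. -/
structure IsClassicalSolution (R : HomogeneousOperator E G gr) (V : Lp ℝ ∞ μ) (u₀ : Lp ℂ 2 μ)
    (T : ℝ) (u : ℝ → Lp ℂ 2 μ) : Prop where
  continuousOn : ContinuousOn u (Icc 0 T)
  initial : u 0 = u₀
  contDiffOn : ContDiffOn ℝ 1 u (Ioc 0 T)
  equation : ∀ t ∈ Ioc 0 T,
    R.HasValue (u t) (-(derivWithin u (Ioc 0 T) t) - (V • u t : Lp ℂ 2 μ))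

/-- Weak solutions on `[0, T]`: `u ∈ C([0,T]; L²)` with `u(0) = u₀`, such that
`d/dt ⟨w, u(t)⟩ = - ⟨R w, u(t)⟩ - ⟨w, V u(t)⟩` on `[0, T]` for all `w` in the domain of `R`. -/
structure IsWeakSolution (R : HomogeneousOperator E G gr) (V : Lp ℝ ∞ μ) (u₀ : Lp ℂ 2 μ)
    (T : ℝ) (u : ℝ → Lp ℂ 2 μ) : Prop where
  continuousOn : ContinuousOn u (Icc 0 T)
  initial : u 0 = u₀
  equation : ∀ w g : Lp ℂ 2 μ, R.HasValue w g → ∀ t ∈ Icc 0 T,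
    HasDerivWithinAt (fun s => inner ℂ w (u s))
      (-(inner ℂ g (u t)) - inner ℂ w (V • u t : Lp ℂ 2 μ)) (Icc 0 T) t

end Operators

end RocklandHeat

end

/-! Put c = ‖V‖ + 1. On test functions R + V + c is symmetric and bounded below by 1, so its
Friedrichs extension has an inverse S = J J*, where J maps the completion in the energy norm to L².
This S is a positive, injective contraction. As V is bounded, it does not change the form domain;
hence Dom R = ran S, and R f = g iff S (g + V f + c f) = f (`exists_inverse`). The Cauchy problem
becomes S (c u - u') = u, with a bounded operator only.

Existence: u(t) = e^{ct} exp(-t S⁻¹) u₀, where exp(-t S⁻¹) is the continuous functional calculus of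
s ↦ exp(-t/s), extended by 0 to s = 0 (`exists_semigroup_orbit`). The spectrum of S lies in [0, 1],
so this operator has norm at most e^{-t}, and e^{(c-1)t} = e^{t‖V‖} is the asserted bound.

Uniqueness: classical and weak solutions v both satisfy (S v)' = c S v - v on (0, T). For a
difference z of two of them, e^{-2ct} ‖S z‖² has derivative -2 e^{-2ct} Re⟨S z, z⟩ ≤ 0 and starts at
0, so S z = 0 and z = 0 (`eqOn_zero_of_hasDerivAt`). -/

namespace RocklandHeat

/-! ### Friedrichs extension of an abstract symmetric operator, through its inverse -/

section Friedrichs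

variable {D H : Type*} [AddCommGroup D] [Module ℂ D]
  [NormedAddCommGroup H] [InnerProductSpace ℂ H] [CompleteSpace H]

/-- `f` lies in the form domain of `T`, where `ι : D → H` is the inclusion of the domain of `T`. -/
def MemFormDomain (ι T : D →ₗ[ℂ] H) (f : H) : Prop :=
  ∃ φ : ℕ → D, Tendsto (fun k => ι (φ k)) atTop (𝓝 f) ∧
    Tendsto (fun p : ℕ × ℕ => (inner ℂ (ι (φ p.1 - φ p.2)) (T (φ p.1 - φ p.2))).re) atTop (𝓝 0)

/-- The energy inner product `⟪ι x, T y⟫` of a positive symmetric operator. -/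
@[reducible] noncomputable def energyCore (ι T : D →ₗ[ℂ] H)
    (symm : ∀ x y, inner ℂ (T x) (ι y) = inner ℂ (ι x) (T y))
    (lb : ∀ x, ‖ι x‖ ^ 2 ≤ (inner ℂ (ι x) (T x)).re) : PreInnerProductSpace.Core ℂ D where
  inner x y := inner ℂ (ι x) (T y)
  conj_inner_symm x y := by rw [inner_conj_symm, symm]
  re_inner_nonneg x := (sq_nonneg _).trans (lb x)
  add_left x y z := by rw [map_add, inner_add_left]
  smul_left x y r := by rw [map_smul, inner_smul_left]

/-- The inverse of the Friedrichs extension of a symmetric operator bounded below by `1`. -/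
theorem exists_friedrichs_inverse (ι T : D →ₗ[ℂ] H) (hι : DenseRange ι)
    (symm : ∀ x y, inner ℂ (T x) (ι y) = inner ℂ (ι x) (T y))
    (lb : ∀ x, ‖ι x‖ ^ 2 ≤ (inner ℂ (ι x) (T x)).re) :
    ∃ S : H →L[ℂ] H, S.IsPositive ∧ ‖S‖ ≤ 1 ∧ Function.Injective S ∧
      ∀ f h, S h = f ↔ MemFormDomain ι T f ∧ ∀ x, inner ℂ (T x) f = inner ℂ (ι x) h := by
  -- The energy form is only a seminorm on `D`, since `ι` need not be injective; the completion is
  -- separated.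
  let c : PreInnerProductSpace.Core ℂ D := energyCore ι T symm lb
  let : SeminormedAddCommGroup D := InnerProductSpace.Core.toSeminormedAddCommGroup (c := c)
  let : InnerProductSpace ℂ D := InnerProductSpace.ofCore c
  have inner_def (x y : D) : inner ℂ x y = inner ℂ (ι x) (T y) := rfl
  have norm_def (x : D) : ‖x‖ ^ 2 = (inner ℂ (ι x) (T x)).re := by
    rw [← inner_def]; exact norm_sq_eq_re_inner (𝕜 := ℂ) x
  let ιc : D →L[ℂ] H := ι.mkContinuous 1 fun x => by
    rw [one_mul]
    exact (pow_le_pow_iff_left₀ (norm_nonneg _) (norm_nonneg _) two_ne_zero).1 ((lb x).trans_eq (norm_def x).symm)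
  let j : D →L[ℂ] UniformSpace.Completion D := UniformSpace.Completion.toComplL
  have hj : DenseRange j := UniformSpace.Completion.denseRange_coe
  have hju : IsUniformInducing j := UniformSpace.Completion.isUniformInducing_coe D
  let J : UniformSpace.Completion D →L[ℂ] H := ιc.extend j
  have hJ (x : D) : J x = ι x := ιc.extend_eq hj hju x
  have hJn : ‖J‖ ≤ 1 := by
    refine J.opNorm_le_bound zero_le_one fun q => ?_
    refine UniformSpace.Completion.induction_on q
      (isClosed_le (by fun_prop) (by fun_prop)) fun x => ?_
    rw [hJ, UniformSpace.Completion.norm_coe, one_mul]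
    exact (pow_le_pow_iff_left₀ (norm_nonneg _) (norm_nonneg _) two_ne_zero).1 ((lb x).trans_eq (norm_def x).symm)
  -- By density this follows from symmetry. It turns the distributional equation for J q into an
  -- identity in the energy space.
  have hT (x : D) (q : UniformSpace.Completion D) :
      inner ℂ (T x) (J q) = inner ℂ (x : UniformSpace.Completion D) q := by
    refine UniformSpace.Completion.induction_on q
      (isClosed_eq (by fun_prop) (by fun_prop)) fun y => ?_
    rw [hJ, symm, UniformSpace.Completion.inner_coe]; rfl
  have hadj (x : D) (h : H) :
      inner ℂ (x : UniformSpace.Completion D) (J.adjoint h) = inner ℂ (ι x) h := by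
    rw [ContinuousLinearMap.adjoint_inner_right, hJ]
  refine ⟨J ∘L J.adjoint, ?_, ?_, ?_, fun f h => ⟨?_, ?_⟩⟩
  · exact ContinuousLinearMap.isPositive_self_comp_adjoint J
  · refine (ContinuousLinearMap.opNorm_comp_le _ _).trans ?_
    rw [LinearIsometryEquiv.norm_map]
    exact mul_le_one₀ hJn (norm_nonneg _) hJn
  · refine (injective_iff_map_eq_zero _).2 fun h hh => ?_
    refine hι.eq_zero_of_inner_right ℂ fun x => ?_
    rw [← hadj, ← hT]
    exact (congrArg _ hh).trans (inner_zero_right _)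
  · rintro rfl
    refine ⟨?_, fun x => by rw [← hadj, ← hT]; rfl⟩
    obtain ⟨a, ha, hlim⟩ := mem_closure_iff_seq_limit.1 (hj (J.adjoint h))
    choose φ hφ using ha
    obtain rfl : (fun k => j (φ k)) = a := funext hφ
    refine ⟨φ, ?_, ?_⟩
    · have := (J.continuous.tendsto _).comp hlim
      refine this.congr fun k => hJ _
    · have hc := (cauchySeq_iff_tendsto.1 hlim.cauchySeq)
      have h2 : Tendsto (fun p : ℕ × ℕ => dist (j (φ p.1)) (j (φ p.2))) atTop (𝓝 0) :=
        cauchySeq_iff_tendsto_dist_atTop_0.1 hlim.cauchySeq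
      have h3 := h2.pow 2
      rw [zero_pow two_ne_zero] at h3
      refine h3.congr fun p => ?_
      rw [← norm_def, dist_eq_norm, ← map_sub]
      congr 1
      exact UniformSpace.Completion.norm_coe _
  · rintro ⟨⟨φ, hφ, hE⟩, hf⟩
    have hc : CauchySeq fun k => j (φ k) := by
      rw [cauchySeq_iff_tendsto_dist_atTop_0]
      have := hE.sqrt
      rw [Real.sqrt_zero] at this
      refine this.congr fun p => ?_
      rw [← norm_def, Real.sqrt_sq (norm_nonneg _), dist_eq_norm, ← map_sub]
      exact (UniformSpace.Completion.norm_coe _).symm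
    obtain ⟨q, hq⟩ := cauchySeq_tendsto_of_complete hc
    have hqf : J q = f := tendsto_nhds_unique
      (((J.continuous.tendsto _).comp hq).congr fun k => hJ _) hφ
    -- Both vectors pair with x to ⟨ι x, h⟩, and such x are dense in the completion.
    have : q = J.adjoint h := by
      refine hj.eq_of_inner_right ℂ fun x => ?_
      exact (hT x q).symm.trans ((hqf ▸ hf x).trans (hadj x h).symm)
    rw [← hqf, this]; rfl

end Friedrichs

/-! ### The semigroup exp(-t S⁻¹) by functional calculus -/

section Semigroup

/-- The function `s ↦ s⁻ᵏ exp (-t / s)`, extended by `0` to `s ≤ 0`. -/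
noncomputable def invExp (k : ℕ) (t s : ℝ) : ℝ :=
  if s ≤ 0 then 0 else s⁻¹ ^ k * Real.exp (-(t * s⁻¹))

theorem invExp_of_pos {k : ℕ} {t s : ℝ} (hs : 0 < s) :
    invExp k t s = s⁻¹ ^ k * Real.exp (-(t * s⁻¹)) := if_neg hs.not_ge

theorem invExp_of_nonpos {k : ℕ} {t s : ℝ} (hs : s ≤ 0) : invExp k t s = 0 := if_pos hs

/-- Exponential decay beats any power of 1/s as s ↓ 0. The function is `expNegInvGlue` at s/t times
(t/s)^k, with the factor t⁻ᵏ restoring s⁻ᵏ. -/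
theorem continuous_invExp (k : ℕ) {t : ℝ} (ht : 0 < t) : Continuous (invExp k t) := by
  have h := ((expNegInvGlue.continuous_polynomial_eval_inv_mul (Polynomial.X ^ k)).comp
    (continuous_id.div_const t)).const_mul (t⁻¹ ^ k)
  convert h using 1
  funext s
  rcases le_or_gt s 0 with hs | hs
  · have h0 : s / t ≤ 0 := div_nonpos_of_nonpos_of_nonneg hs ht.le
    simp [invExp_of_nonpos hs, expNegInvGlue.zero_of_nonpos h0]
  · have h0 : ¬ s / t ≤ 0 := (div_pos hs ht).not_ge
    simp only [invExp_of_pos hs, Function.comp, id, Polynomial.eval_pow, Polynomial.eval_X,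
      expNegInvGlue, if_neg h0, inv_div, ← mul_assoc, ← mul_pow]
    congr 2
    field_simp

theorem mul_invExp_succ (k : ℕ) (t s : ℝ) : s * invExp (k + 1) t s = invExp k t s := by
  rcases le_or_gt s 0 with hs | hs
  · simp [invExp_of_nonpos hs]
  · rw [invExp_of_pos hs, invExp_of_pos hs, pow_succ]
    field_simp

theorem abs_invExp_zero_le {t s : ℝ} (ht : 0 ≤ t) (hs : s ≤ 1) :
    |invExp 0 t s| ≤ Real.exp (-t) := by
  rcases le_or_gt s 0 with h | h
  · simp [invExp_of_nonpos h, Real.exp_nonneg]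
  · rw [invExp_of_pos h, pow_zero, one_mul, Real.abs_exp, Real.exp_le_exp, neg_le_neg_iff]
    exact le_mul_of_one_le_right ht ((one_le_inv₀ h).2 hs)

/-- Multiply 0 ≤ 1 - e^{-x} ≤ x at x = t/s by s: the bound is uniform in s. -/
theorem abs_mul_one_sub_invExp_zero_le {t s : ℝ} (ht : 0 ≤ t) (hs : 0 ≤ s) :
    |s - invExp 0 t s * s| ≤ t := by
  rcases hs.eq_or_lt with rfl | h
  · simpa using ht
  · rw [invExp_of_pos h, pow_zero, one_mul, mul_comm]
    have h1 := Real.add_one_le_exp (-(t * s⁻¹))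
    have h2 : Real.exp (-(t * s⁻¹)) ≤ 1 := Real.exp_le_one_iff.2 (by
      have := mul_nonneg ht (inv_nonneg.2 hs); linarith)
    rw [abs_of_nonneg (by nlinarith)]
    have h3 : s * (1 - t * s⁻¹) = s - t := by field_simp
    nlinarith

theorem abs_exp_sub_one_sub_le (x : ℝ) :
    |Real.exp x - 1 - x| ≤ x ^ 2 * Real.exp |x| := by
  have := Complex.norm_exp_sub_sum_le_norm_mul_exp (x : ℂ) 2
  simp only [Finset.sum_range_succ, Finset.sum_range_zero] at this
  rw [Complex.norm_real, Real.norm_eq_abs, sq_abs] at this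
  convert this using 1
  rw [← Real.norm_eq_abs, ← Complex.norm_real]
  congr 1
  push_cast
  simp
  ring

/-- Second-order Taylor estimate in t. The remainder carries a factor e^{|r|/s}, absorbed by
lowering the decay rate from t to a. -/
theorem abs_invExp_add_sub_le (k : ℕ) {a t r s : ℝ} (hr : a + |r| ≤ t) :
    |invExp k (t + r) s - invExp k t s + r * invExp (k + 1) t s| ≤ r ^ 2 * invExp (k + 2) a s := by
  rcases le_or_gt s 0 with h | h
  · simp [invExp_of_nonpos h]
  · simp only [invExp_of_pos h]
    have hs : 0 < s⁻¹ := inv_pos.2 h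
    have key := abs_exp_sub_one_sub_le (-(r * s⁻¹))
    have e1 : s⁻¹ ^ k * Real.exp (-((t + r) * s⁻¹)) - s⁻¹ ^ k * Real.exp (-(t * s⁻¹)) +
        r * (s⁻¹ ^ (k + 1) * Real.exp (-(t * s⁻¹))) =
        s⁻¹ ^ k * Real.exp (-(t * s⁻¹)) *
          (Real.exp (-(r * s⁻¹)) - 1 - (-(r * s⁻¹))) := by
      rw [show -((t + r) * s⁻¹) = -(t * s⁻¹) + -(r * s⁻¹) by ring, Real.exp_add]; ring
    rw [e1, abs_mul, abs_of_pos (by positivity)]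
    calc _ ≤ s⁻¹ ^ k * Real.exp (-(t * s⁻¹)) *
          ((-(r * s⁻¹)) ^ 2 * Real.exp |-(r * s⁻¹)|) := by gcongr
      _ = r ^ 2 * (s⁻¹ ^ (k + 2) * Real.exp (-((t - |r|) * s⁻¹))) := by
        rw [abs_neg, abs_mul, abs_of_pos hs,
          show -((t - |r|) * s⁻¹) = -(t * s⁻¹) + |r| * s⁻¹ by ring, Real.exp_add]; ring
      _ ≤ _ := by gcongr; linarith

variable {H : Type*} [NormedAddCommGroup H] [InnerProductSpace ℂ H] [CompleteSpace H]

theorem spectrum_subset_Icc {S : H →L[ℂ] H} (hS : S.IsPositive) (hS1 : ‖S‖ ≤ 1) :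
    spectrum ℝ S ⊆ Icc 0 1 := by
  intro x hx
  refine ⟨spectrum_nonneg_of_nonneg ((ContinuousLinearMap.nonneg_iff_isPositive S).2 hS) hx, ?_⟩
  have h1 : ‖x‖ ≤ ‖S‖ * ‖(1 : H →L[ℂ] H)‖ := spectrum.norm_le_norm_mul_of_mem hx
  -- Equality fails if `H` is trivial.
  have h2 : ‖(1 : H →L[ℂ] H)‖ ≤ 1 := ContinuousLinearMap.norm_id_le
  exact (le_abs_self x).trans (h1.trans (mul_le_one₀ hS1 (norm_nonneg _) h2))

theorem hasDerivAt_cfc_invExp {S : H →L[ℂ] H} (hS : S.IsPositive) (hS1 : ‖S‖ ≤ 1)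
    (k : ℕ) {t : ℝ} (ht : 0 < t) :
    HasDerivAt (fun t => cfc (invExp k t) S) (-cfc (invExp (k + 1) t) S) t := by
  have hsa : IsSelfAdjoint S := hS.isSelfAdjoint
  obtain ⟨C, hC⟩ := (isCompact_Icc (a := (0 : ℝ)) (b := 1)).exists_bound_of_continuousOn
    (continuous_invExp (k + 2) (half_pos ht)).continuousOn
  have hC0 : 0 ≤ C := (norm_nonneg _).trans (hC 0 ⟨le_rfl, zero_le_one⟩)
  rw [hasDerivAt_iff_isLittleO_nhds_zero]
  -- For |r| < t/2 the Taylor estimate applies with a = t/2, and `C` bounds its remainder uniformly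
  -- on the spectrum, hence in operator norm.
  have hO : (fun r : ℝ => cfc (invExp k (t + r)) S - cfc (invExp k t) S -
      r • -cfc (invExp (k + 1) t) S) =O[𝓝 0] fun r : ℝ => r ^ 2 := by
    refine Asymptotics.IsBigO.of_bound C ?_
    filter_upwards [Metric.ball_mem_nhds (0 : ℝ) (half_pos ht)] with r hr
    rw [Metric.mem_ball, dist_zero_right, Real.norm_eq_abs] at hr
    have htr : 0 < t + r := by have := neg_abs_le r; linarith
    have c1 := (continuous_invExp k htr).continuousOn (s := spectrum ℝ S)
    have c2 := (continuous_invExp k ht).continuousOn (s := spectrum ℝ S)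
    have c3 := (continuous_invExp (k + 1) ht).continuousOn (s := spectrum ℝ S)
    rw [smul_neg, sub_neg_eq_add, ← cfc_sub .., ← cfc_smul r .., ← cfc_add ..]
    refine norm_cfc_le (by positivity) fun s hs => ?_
    rw [Real.norm_eq_abs, Real.norm_eq_abs, abs_of_nonneg (sq_nonneg r), mul_comm]
    refine (abs_invExp_add_sub_le k (a := t / 2) (by linarith)).trans ?_
    gcongr
    exact (le_abs_self _).trans (hC s (spectrum_subset_Icc hS hS1 hs))
  exact hO.trans_isLittleO (by simpa using Asymptotics.isLittleO_pow_id (𝕜 := ℝ) one_lt_two)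

theorem mul_cfc_invExp_succ {S : H →L[ℂ] H} (hS : S.IsPositive) (k : ℕ) {t : ℝ} (ht : 0 < t) :
    S * cfc (invExp (k + 1) t) S = cfc (invExp k t) S := by
  have hsa : IsSelfAdjoint S := hS.isSelfAdjoint
  have c := (continuous_invExp (k + 1) ht).continuousOn (s := spectrum ℝ S)
  nth_rw 1 [← cfc_id' ℝ S]
  rw [← cfc_mul ..]
  exact cfc_congr fun s _ => mul_invExp_succ k t s

theorem norm_cfc_invExp_zero_le {S : H →L[ℂ] H} (hS : S.IsPositive) (hS1 : ‖S‖ ≤ 1)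
    {t : ℝ} (ht : 0 ≤ t) : ‖cfc (invExp 0 t) S‖ ≤ Real.exp (-t) :=
  norm_cfc_le (Real.exp_nonneg _) fun _ hs =>
    abs_invExp_zero_le ht (spectrum_subset_Icc hS hS1 hs).2

theorem norm_sub_cfc_invExp_zero_mul_le {S : H →L[ℂ] H} (hS : S.IsPositive) (hS1 : ‖S‖ ≤ 1)
    {t : ℝ} (ht : 0 < t) : ‖S - cfc (invExp 0 t) S * S‖ ≤ t := by
  have hsa : IsSelfAdjoint S := hS.isSelfAdjoint
  have c := (continuous_invExp 0 ht).continuousOn (s := spectrum ℝ S)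
  have : S - cfc (invExp 0 t) S * S = cfc (fun s => s - invExp 0 t s * s) S := by
    rw [cfc_sub .., cfc_mul .., cfc_id' ℝ S]
  rw [this]
  exact norm_cfc_le ht.le fun s hs =>
    abs_mul_one_sub_invExp_zero_le ht.le (spectrum_subset_Icc hS hS1 hs).1

/-- For a self-adjoint operator the orthogonal complement of the range is the kernel. -/
theorem denseRange_of_isPositive {S : H →L[ℂ] H} (hS : S.IsPositive)
    (hinj : Function.Injective S) : DenseRange S := by
  have h : S.range.topologicalClosure = ⊤ := by
    rw [Submodule.topologicalClosure_eq_top_iff, Submodule.eq_bot_iff]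
    intro x hx
    refine hinj (?_ : S x = S 0)
    rw [map_zero]
    refine ext_inner_left ℂ fun y => ?_
    rw [inner_zero_right, ← hS.inner_left_eq_inner_right]
    exact Submodule.inner_right_of_mem_orthogonal (LinearMap.mem_range_self _ y) hx
  exact Submodule.dense_iff_topologicalClosure_eq_top.2 h

/-- Convergence is strong, not asserted in norm: on vectors S y the error is at most t‖y‖, such
vectors are dense, and the operators are contractions. -/
theorem tendsto_cfc_invExp_zero {S : H →L[ℂ] H} (hS : S.IsPositive) (hS1 : ‖S‖ ≤ 1)
    (hinj : Function.Injective S) (x : H) :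
    Tendsto (fun t => cfc (invExp 0 t) S x) (𝓝[>] 0) (𝓝 x) := by
  rw [Metric.tendsto_nhds]
  intro ε hε
  obtain ⟨y, hy⟩ := (denseRange_of_isPositive hS hinj).exists_dist_lt x (by positivity : 0 < ε / 3)
  have h0 : Tendsto (fun t : ℝ => t * ‖y‖) (𝓝[>] 0) (𝓝 0) := by
    have : Tendsto (fun t : ℝ => t * ‖y‖) (𝓝 0) (𝓝 (0 * ‖y‖)) :=
      (continuous_id.mul continuous_const).tendsto 0
    rw [zero_mul] at this
    exact this.mono_left nhdsWithin_le_nhds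
  filter_upwards [h0.eventually_lt_const (by positivity : 0 < ε / 3), self_mem_nhdsWithin]
    with t hty ht
  have ht : 0 < t := ht
  rw [dist_eq_norm] at hy
  rw [dist_eq_norm]
  set F := cfc (invExp 0 t) S
  have e : F x - x = F (x - S y) + -((S - F * S) y) + (S y - x) := by
    simp [map_sub]
  have hF : ‖F‖ ≤ 1 := (norm_cfc_invExp_zero_le hS hS1 ht.le).trans
    (Real.exp_le_one_iff.2 (by linarith))
  have b1 : ‖F (x - S y)‖ ≤ 1 * ‖x - S y‖ := F.le_of_opNorm_le hF _
  have b2 : ‖(S - F * S) y‖ ≤ t * ‖y‖ :=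
    ContinuousLinearMap.le_of_opNorm_le _ (norm_sub_cfc_invExp_zero_mul_le hS hS1 ht) _
  have b3 := norm_add₃_le (a := F (x - S y)) (b := -((S - F * S) y)) (c := S y - x)
  rw [norm_neg, norm_sub_rev (S y) x] at b3
  rw [e]
  linarith

/-- The orbit `t ↦ exp (-t S⁻¹) x` of the semigroup generated by `-S⁻¹`, where `h t` is
`S⁻¹ exp (-t S⁻¹) x`. -/
theorem exists_semigroup_orbit {S : H →L[ℂ] H} (hS : S.IsPositive) (hS1 : ‖S‖ ≤ 1)
    (hinj : Function.Injective S) (x : H) :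
    ∃ p h : ℝ → H, p 0 = x ∧ ContinuousOn p (Ici 0) ∧
      (∀ t, 0 ≤ t → ‖p t‖ ≤ Real.exp (-t) * ‖x‖) ∧
      (∀ t, 0 < t → HasDerivAt p (-h t) t ∧ S (h t) = p t) ∧ ContinuousOn h (Ioi 0) := by
  have hd (k : ℕ) {t : ℝ} (ht : 0 < t) :
      HasDerivAt (fun t => cfc (invExp k t) S x) (-cfc (invExp (k + 1) t) S x) t :=
    ((ContinuousLinearMap.apply ℂ H x).restrictScalars ℝ).hasFDerivAt.comp_hasDerivAt t
      (hasDerivAt_cfc_invExp hS hS1 k ht)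
  -- The value at 0 is set by hand: `invExp 0 0` jumps at s = 0, so there `cfc` may return its
  -- default value 0.
  let p : ℝ → H := fun t => if t ≤ 0 then x else cfc (invExp 0 t) S x
  have hp {t : ℝ} (ht : 0 < t) : p =ᶠ[𝓝 t] fun t => cfc (invExp 0 t) S x := by
    filter_upwards [Ioi_mem_nhds ht] with r hr using if_neg (not_le.2 hr)
  have hp0 : p 0 = x := if_pos le_rfl
  refine ⟨p, fun t => cfc (invExp 1 t) S x, hp0, ?_, ?_, ?_, ?_⟩
  · intro t ht
    rcases (show 0 ≤ t from ht).eq_or_lt with rfl | ht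
    · rw [← Ioi_insert, continuousWithinAt_insert_self, ContinuousWithinAt, hp0]
      refine (tendsto_cfc_invExp_zero hS hS1 hinj x).congr' ?_
      filter_upwards [self_mem_nhdsWithin] with r hr using (if_neg (not_le.2 hr)).symm
    · exact ((hd 0 ht).congr_of_eventuallyEq (hp ht)).continuousAt.continuousWithinAt
  · intro t ht
    rcases ht.eq_or_lt with rfl | ht
    · simp [hp0]
    · rw [(hp ht).eq_of_nhds]
      exact ContinuousLinearMap.le_of_opNorm_le _ (norm_cfc_invExp_zero_le hS hS1 ht.le) x
  · intro t ht
    refine ⟨(hd 0 ht).congr_of_eventuallyEq (hp ht), ?_⟩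
    rw [(hp ht).eq_of_nhds, ← mul_cfc_invExp_succ hS 0 ht]
    rfl
  · exact fun t ht => (hd 1 ht).continuousAt.continuousWithinAt

end Semigroup

/-! ### Energy estimate and weak derivatives -/

section Uniqueness

variable {H : Type*} [NormedAddCommGroup H] [InnerProductSpace ℂ H]

/-- The energy estimate for `z' = c z - S⁻¹ z`, in the form `(S z)' = c S z - z`. -/
theorem eqOn_zero_of_hasDerivAt {S : H →L[ℂ] H} (hS : S.IsPositive)
    (hinj : Function.Injective S) {c T : ℝ} {z : ℝ → H} (hz : ContinuousOn z (Icc 0 T))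
    (hz0 : z 0 = 0)
    (hd : ∀ t ∈ Ioo 0 T, HasDerivAt (fun s => S (z s)) (c • S (z t) - z t) t) :
    EqOn z 0 (Icc 0 T) := by
  -- The weight e^{-2ct} cancels the term from c S z, leaving -2 e^{-2ct} Re⟨S z, z⟩.
  have hanti : AntitoneOn (fun t => Real.exp (-(2 * c * t)) * ‖S (z t)‖ ^ 2) (Icc 0 T) := by
    have hSz : ContinuousOn (fun t => S (z t)) (Icc 0 T) := S.continuous.comp_continuousOn hz
    have hD (t : ℝ) (ht : t ∈ Ioo 0 T) :
        HasDerivAt (fun t => Real.exp (-(2 * c * t)) * ‖S (z t)‖ ^ 2)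
          (-2 * Real.exp (-(2 * c * t)) * (inner ℂ (S (z t)) (z t)).re) t := by
      let : InnerProductSpace ℝ H := InnerProductSpace.rclikeToReal ℂ H
      have h1 : HasDerivAt (fun t : ℝ => Real.exp (-(2 * c * t)))
          (Real.exp (-(2 * c * t)) * -(2 * c * 1)) t :=
        ((hasDerivAt_id t).const_mul (2 * c)).neg.exp
      have h2 := h1.mul (hd t ht).norm_sq
      refine h2.congr_deriv ?_
      rw [inner_sub_right, real_inner_smul_right, real_inner_self_eq_norm_sq]
      have : inner ℝ (S (z t)) (z t) = (inner ℂ (S (z t)) (z t)).re := rfl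
      rw [this]
      ring
    refine antitoneOn_of_deriv_nonpos (convex_Icc 0 T) ?_ ?_ ?_
    · exact ContinuousOn.mul (by fun_prop) (hSz.norm.pow 2)
    · rw [interior_Icc]
      exact fun t ht => (hD t ht).differentiableAt.differentiableWithinAt
    · rw [interior_Icc]
      intro t ht
      rw [(hD t ht).deriv]
      have h1 : 0 ≤ (inner ℂ (S (z t)) (z t)).re := hS.re_inner_nonneg_left (z t)
      have h2 := Real.exp_pos (-(2 * c * t))
      nlinarith [mul_nonneg h2.le h1]
  intro t ht
  have h := hanti ⟨le_rfl, ht.1.trans ht.2⟩ ht ht.1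
  simp only [hz0, map_zero, norm_zero, ne_eq, OfNat.ofNat_ne_zero, not_false_eq_true, zero_pow,
    mul_zero] at h
  have h2 : ‖S (z t)‖ ^ 2 ≤ 0 := nonpos_of_mul_nonpos_right h (Real.exp_pos _)
  have h3 : S (z t) = S 0 := by
    rw [map_zero, ← norm_eq_zero]
    exact pow_eq_zero_iff two_ne_zero |>.1 (le_antisymm h2 (sq_nonneg _))
  exact hinj h3

theorem eqOn_of_hasDerivAt {S : H →L[ℂ] H} (hS : S.IsPositive)
    (hinj : Function.Injective S) {c T : ℝ} {v u : ℝ → H} (hv : ContinuousOn v (Icc 0 T))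
    (hu : ContinuousOn u (Icc 0 T)) (h0 : v 0 = u 0)
    (hdv : ∀ t ∈ Ioo 0 T, HasDerivAt (fun s => S (v s)) (c • S (v t) - v t) t)
    (hdu : ∀ t ∈ Ioo 0 T, HasDerivAt (fun s => S (u s)) (c • S (u t) - u t) t) :
    EqOn v u (Icc 0 T) := by
  have hzero : EqOn (fun t => v t - u t) 0 (Icc 0 T) := by
    refine eqOn_zero_of_hasDerivAt (c := c) hS hinj (hv.sub hu) (sub_eq_zero.2 h0) fun t ht => ?_
    simp only [map_sub]
    refine ((hdv t ht).sub (hdu t ht)).congr_deriv ?_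
    rw [smul_sub]
    abel
  exact fun t ht => sub_eq_zero.1 (hzero ht)

/-- A function with a continuous weak derivative is differentiable. -/
theorem hasDerivAt_of_inner [CompleteSpace H] {T : ℝ} {y g : ℝ → H} (hg : ContinuousOn g (Icc 0 T))
    (hy : ContinuousOn y (Icc 0 T))
    (hd : ∀ k : H, ∀ t ∈ Ioo 0 T, HasDerivAt (fun s => inner ℂ k (y s)) (inner ℂ k (g t)) t)
    {t : ℝ} (ht : t ∈ Ioo 0 T) : HasDerivAt y (g t) t := by
  have hint {s : ℝ} (hs : s ∈ Icc 0 T) : IntervalIntegrable g volume 0 s :=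
    (hg.mono (by rw [uIcc_of_le hs.1]; exact Icc_subset_Icc_right hs.2)).intervalIntegrable
  -- The scalar fundamental theorem of calculus, paired with every `k`, makes y a primitive of the
  -- continuous function g.
  have key {s : ℝ} (hs : s ∈ Icc 0 T) : y s = (∫ r in (0 : ℝ)..s, g r) + y 0 := by
    refine ext_inner_left ℂ fun k => ?_
    have h1 : ∫ r in (0 : ℝ)..s, inner ℂ k (g r) = inner ℂ k (y s) - inner ℂ k (y 0) := by
      refine intervalIntegral.integral_eq_sub_of_hasDerivAt_of_le
        (f := fun r => (inner ℂ k (y r) : ℂ)) (f' := fun r => (inner ℂ k (g r) : ℂ)) hs.1 ?_ ?_ ?_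
      · exact (ContinuousOn.inner (𝕜 := ℂ) continuousOn_const hy).mono (Icc_subset_Icc_right hs.2)
      · exact fun r hr => hd k r ⟨hr.1, hr.2.trans_le hs.2⟩
      · refine ContinuousOn.intervalIntegrable ((ContinuousOn.inner (𝕜 := ℂ) continuousOn_const hg).mono ?_)
        rw [uIcc_of_le hs.1]
        exact Icc_subset_Icc_right hs.2
    have h2 : ∫ r in (0 : ℝ)..s, inner ℂ k (g r) = inner ℂ k (∫ r in (0 : ℝ)..s, g r) :=
      (innerSL ℂ k : H →L[ℂ] ℂ).intervalIntegral_comp_comm (hint hs)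
    rw [inner_add_right, ← h2, h1, sub_add_cancel]
  have hnhds : Icc 0 T ∈ 𝓝 t := Icc_mem_nhds ht.1 ht.2
  have h1 : HasDerivAt (fun s => (∫ r in (0 : ℝ)..s, g r) + y 0) (g t) t := by
    refine (intervalIntegral.integral_hasDerivAt_right (hint (Ioo_subset_Icc_self ht)) ?_
      (hg.continuousAt hnhds)).add_const _
    exact (hg.mono Ioo_subset_Icc_self).stronglyMeasurableAtFilter isOpen_Ioo t ht
  exact h1.congr_of_eventuallyEq (by filter_upwards [hnhds] with s hs using key hs)

end Uniqueness

/-! ### R as a linear operator on test functions -/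

section TestFunctions

variable {E : Type*} [NormedAddCommGroup E] [NormedSpace ℝ E]
  {G : Type*} [TopologicalSpace G] [ChartedSpace E G]

variable (E G) in
/-- The space of test functions. -/
def testFunctions : Submodule ℂ (G → ℂ) where
  carrier := {φ | IsTestFunction E φ}
  add_mem' hf hg := ⟨hf.1.add hg.1, hf.2.add hg.2⟩
  zero_mem' := ⟨contMDiff_const, HasCompactSupport.zero⟩
  smul_mem' c f hf := ⟨by
    have h : ContMDiff 𝓘(ℝ, ℂ) 𝓘(ℝ, ℂ) ∞ fun z : ℂ => c • z :=
      ((c • ContinuousLinearMap.id ℝ ℂ : ℂ →L[ℝ] ℂ)).contMDiff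
    exact h.comp hf.1, hf.2.smul_left (f := fun _ => c)⟩

theorem IsTestFunction.mdifferentiable {φ : G → ℂ} (h : IsTestFunction E φ) :
    MDifferentiable 𝓘(ℝ, E) 𝓘(ℝ, ℂ) φ := h.1.mdifferentiable (by simp)

variable [Group G]

/-- Left-invariant vector fields on a smooth Lie group are smooth. -/
theorem contMDiff_infty_mulInvariantVectorField [LieGroup 𝓘(ℝ, E) ∞ G]
    (v : GroupLieAlgebra 𝓘(ℝ, E) G) :
    ContMDiff 𝓘(ℝ, E) 𝓘(ℝ, E).tangent ∞
      (fun g : G => (mulInvariantVectorField v g : TangentBundle 𝓘(ℝ, E) G)) := by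
  have : IsManifold 𝓘(ℝ, E) ((∞ : WithTop ℕ∞) + 1) G := inferInstanceAs (IsManifold 𝓘(ℝ, E) ∞ G)
  -- The field at g is the differential of multiplication at (g, 1) applied to (0, v), so it is a
  -- composite of smooth maps.
  let fg : G → TangentBundle 𝓘(ℝ, E) G := fun g => Bundle.TotalSpace.mk' E g 0
  have sfg : ContMDiff 𝓘(ℝ, E) 𝓘(ℝ, E).tangent ∞ fg := Bundle.contMDiff_zeroSection _ _
  let fv : G → TangentBundle 𝓘(ℝ, E) G := fun _ => Bundle.TotalSpace.mk' E 1 v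
  have sfv : ContMDiff 𝓘(ℝ, E) 𝓘(ℝ, E).tangent ∞ fv := contMDiff_const
  let F₁ : G → TangentBundle 𝓘(ℝ, E) G × TangentBundle 𝓘(ℝ, E) G := fun g => (fg g, fv g)
  have S₁ : ContMDiff 𝓘(ℝ, E) (𝓘(ℝ, E).tangent.prod 𝓘(ℝ, E).tangent) ∞ F₁ := sfg.prodMk sfv
  let F₂ : TangentBundle 𝓘(ℝ, E) G × TangentBundle 𝓘(ℝ, E) G →
      TangentBundle (𝓘(ℝ, E).prod 𝓘(ℝ, E)) (G × G) :=
    (equivTangentBundleProd 𝓘(ℝ, E) G 𝓘(ℝ, E) G).symm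
  have S₂ : ContMDiff (𝓘(ℝ, E).tangent.prod 𝓘(ℝ, E).tangent)
      (𝓘(ℝ, E).prod 𝓘(ℝ, E)).tangent ∞ F₂ := contMDiff_equivTangentBundleProd_symm
  let F₃ : TangentBundle (𝓘(ℝ, E).prod 𝓘(ℝ, E)) (G × G) → TangentBundle 𝓘(ℝ, E) G :=
    tangentMap (𝓘(ℝ, E).prod 𝓘(ℝ, E)) 𝓘(ℝ, E) (fun p : G × G => p.1 * p.2)
  have S₃ : ContMDiff (𝓘(ℝ, E).prod 𝓘(ℝ, E)).tangent 𝓘(ℝ, E).tangent ∞ F₃ :=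
    (contMDiff_mul 𝓘(ℝ, E) ∞).contMDiff_tangentMap (m := ∞) le_rfl
  let S := (S₃.comp S₂).comp S₁
  convert! S with g
  · simp [F₁, F₂, F₃, fg, fv]
  · simp only [Function.comp_apply, tangentMap, F₃, F₂, F₁, fg, fv]
    rw [mfderiv_prod_eq_add_apply ((contMDiff_mul 𝓘(ℝ, E) ∞).mdifferentiableAt (by simp))]
    change mfderiv 𝓘(ℝ, E) 𝓘(ℝ, E) (fun z : G => g * z) 1 v =
      mfderiv 𝓘(ℝ, E) 𝓘(ℝ, E) (fun z : G => z * 1) g 0 +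
        mfderiv 𝓘(ℝ, E) 𝓘(ℝ, E) (fun z : G => g * z) 1 v
    rw [map_zero]
    exact (zero_add _).symm

theorem contMDiff_leftInvDeriv [LieGroup 𝓘(ℝ, E) ∞ G] (v : GroupLieAlgebra 𝓘(ℝ, E) G)
    {f : G → ℂ} (hf : ContMDiff 𝓘(ℝ, E) 𝓘(ℝ, ℂ) ∞ f) :
    ContMDiff 𝓘(ℝ, E) 𝓘(ℝ, ℂ) ∞ (leftInvDeriv v f) :=
  ((contMDiff_snd_tangentBundle_modelSpace ℂ 𝓘(ℝ, ℂ)).comp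
    (hf.contMDiff_tangentMap (m := ∞) le_rfl)).comp (contMDiff_infty_mulInvariantVectorField v)

theorem support_leftInvDeriv_subset (v : GroupLieAlgebra 𝓘(ℝ, E) G) (f : G → ℂ) :
    Function.support (leftInvDeriv v f) ⊆ tsupport f := by
  intro x hx
  by_contra h
  refine hx ?_
  have : f =ᶠ[𝓝 x] fun _ => 0 := notMem_tsupport_iff_eventuallyEq.1 h
  rw [leftInvDeriv, this.mfderiv_eq, mfderiv_const]
  rfl

theorem leftInvDeriv_add (v : GroupLieAlgebra 𝓘(ℝ, E) G) {f g : G → ℂ}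
    (hf : MDifferentiable 𝓘(ℝ, E) 𝓘(ℝ, ℂ) f) (hg : MDifferentiable 𝓘(ℝ, E) 𝓘(ℝ, ℂ) g) :
    leftInvDeriv v (f + g) = leftInvDeriv v f + leftInvDeriv v g := by
  funext x
  rw [leftInvDeriv, mfderiv_add (hf x) (hg x)]
  rfl

theorem leftInvDeriv_smul (v : GroupLieAlgebra 𝓘(ℝ, E) G) (c : ℂ) {f : G → ℂ}
    (hf : MDifferentiable 𝓘(ℝ, E) 𝓘(ℝ, ℂ) f) :
    leftInvDeriv v (c • f) = c • leftInvDeriv v f := by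
  funext x
  -- The scalar is complex but differentiability is real, so multiplication by c enters as an
  -- ℝ-linear map in the chain rule.
  have h : HasMFDerivAt 𝓘(ℝ, ℂ) 𝓘(ℝ, ℂ) (fun z : ℂ => c • z) (f x)
      (c • ContinuousLinearMap.id ℝ ℂ : ℂ →L[ℝ] ℂ) :=
    (c • ContinuousLinearMap.id ℝ ℂ : ℂ →L[ℝ] ℂ).hasMFDerivAt
  have h2 := (h.comp x (hf x).hasMFDerivAt).mfderiv
  exact DFunLike.congr_fun h2 (mulInvariantVectorField v x)

variable [LieGroup 𝓘(ℝ, E) ∞ G]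

/-- Left-invariant vector fields acting on test functions. -/
noncomputable def leftInvDerivEnd (v : GroupLieAlgebra 𝓘(ℝ, E) G) :
    Module.End ℂ (testFunctions E G) where
  toFun φ := ⟨leftInvDeriv v φ, contMDiff_leftInvDeriv v φ.2.1,
    φ.2.2.mono' (support_leftInvDeriv_subset v _)⟩
  map_add' φ ψ := Subtype.ext (leftInvDeriv_add v φ.2.mdifferentiable ψ.2.mdifferentiable)
  map_smul' c φ := Subtype.ext (leftInvDeriv_smul v c φ.2.mdifferentiable)

variable {gr : LieGrading E G}

/-- The operator `R` acting on test functions. -/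
noncomputable def HomogeneousOperator.onTest (R : HomogeneousOperator E G gr) :
    Module.End ℂ (testFunctions E G) :=
  ∑ α ∈ R.coeff.support, R.coeff α •
    (List.finRange R.n).foldr (fun j L => leftInvDerivEnd (R.basis j) ^ α j * L) 1

/-- `apply` is defined on all functions, with default values where derivatives do not exist; on test
functions it agrees with a genuine linear endomorphism. -/
theorem HomogeneousOperator.coe_onTest (R : HomogeneousOperator E G gr)
    (φ : testFunctions E G) : (R.onTest φ : G → ℂ) = R.apply φ := by
  have hpow (v : GroupLieAlgebra 𝓘(ℝ, E) G) (k : ℕ) (ψ : testFunctions E G) :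
      (((leftInvDerivEnd v ^ k) ψ : testFunctions E G) : G → ℂ) = (leftInvDeriv v)^[k] ψ := by
    induction k with
    | zero => rfl
    | succ k ih => rw [pow_succ', Function.iterate_succ_apply', ← ih]; rfl
  have hfold (α : Fin R.n → ℕ) (l : List (Fin R.n)) :
      ((l.foldr (fun j L => leftInvDerivEnd (R.basis j) ^ α j * L) 1 φ : testFunctions E G) :
        G → ℂ) = l.foldr (fun j x => (leftInvDeriv (R.basis j))^[α j] x) φ := by
    induction l with
    | nil => rfl
    | cons j l ih => rw [List.foldr_cons, List.foldr_cons, ← ih, ← hpow]; rfl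
  simp only [onTest, apply, orderedMonomial, LinearMap.sum_apply, LinearMap.smul_apply,
    AddSubmonoidClass.coe_finsetSum, SetLike.val_smul, hfold]

end TestFunctions

/-! ### The Cauchy problem in terms of S -/

section AbstractCauchyProblem

variable {H : Type*} [NormedAddCommGroup H] [InnerProductSpace ℂ H]

/-- The orbit `t ↦ exp (t (c - S⁻¹)) x` is a classical solution of `u' + S⁻¹ u = c u`. -/
theorem exists_classical_solution [CompleteSpace H] {S : H →L[ℂ] H} (hS : S.IsPositive)
    (hS1 : ‖S‖ ≤ 1) (hinj : Function.Injective S) (c : ℝ) (x : H) :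
    ∃ u : ℝ → H, u 0 = x ∧ ContinuousOn u (Ici 0) ∧
      (∀ t, 0 ≤ t → ‖u t‖ ≤ Real.exp (t * (c - 1)) * ‖x‖) ∧
      ContDiffOn ℝ 1 u (Ioi 0) ∧ ∀ t, 0 < t → S (-deriv u t + c • u t) = u t := by
  obtain ⟨p, h, hp0, hpc, hpn, hph, hhc⟩ := exists_semigroup_orbit hS hS1 hinj x
  have hexp : Continuous fun t : ℝ => Real.exp (c * t) := by fun_prop
  have hd {t : ℝ} (ht : 0 < t) : HasDerivAt (fun t => Real.exp (c * t) • p t)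
      (c • (Real.exp (c * t) • p t) - Real.exp (c * t) • h t) t := by
    have h1 : HasDerivAt (fun t : ℝ => Real.exp (c * t)) (Real.exp (c * t) * (c * 1)) t :=
      ((hasDerivAt_id t).const_mul c).exp
    refine (h1.smul (hph t ht).1).congr_deriv ?_
    rw [smul_smul, smul_neg, mul_one, mul_comm c (Real.exp _), add_comm]
    exact (sub_eq_add_neg _ _).symm
  refine ⟨fun t => Real.exp (c * t) • p t, by simp [hp0], hexp.continuousOn.smul hpc, ?_, ?_, ?_⟩
  · intro t ht
    rw [norm_smul, Real.norm_eq_abs, Real.abs_exp]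
    calc _ ≤ Real.exp (c * t) * (Real.exp (-t) * ‖x‖) := by gcongr; exact hpn t ht
      _ = _ := by rw [← mul_assoc, ← Real.exp_add]; ring_nf
  · rw [show (1 : WithTop ℕ∞) = 0 + 1 from (zero_add 1).symm,
      contDiffOn_succ_iff_deriv_of_isOpen isOpen_Ioi]
    refine ⟨fun t ht => (hd ht).differentiableAt.differentiableWithinAt, by simp,
      contDiffOn_zero.2 ?_⟩
    refine ContinuousOn.congr (f := fun t =>
      c • (Real.exp (c * t) • p t) - Real.exp (c * t) • h t) ?_ fun t ht => (hd ht).deriv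
    exact ((hexp.continuousOn.smul (hpc.mono Ioi_subset_Ici_self)).const_smul c).sub
      (hexp.continuousOn.smul hhc)
  · intro t ht
    rw [(hd ht).deriv, neg_sub, sub_add_cancel]
    refine (map_smul (S.restrictScalars ℝ) _ _).trans ?_
    exact congrArg _ (hph t ht).2

/-- Classical solutions of `u' + S⁻¹ u = c u` are weak solutions, up to time `0`. -/
theorem hasDerivWithinAt_inner {S : H →L[ℂ] H} (hS : S.IsPositive) {c T : ℝ} (hT : 0 < T)
    {u : ℝ → H} (hc : ContinuousOn u (Icc 0 T)) (hu : DifferentiableOn ℝ u (Ioi 0))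
    (heq : ∀ t, 0 < t → S (-deriv u t + c • u t) = u t) (k : H) {t : ℝ} (ht : t ∈ Icc 0 T) :
    HasDerivWithinAt (fun s => (inner ℂ (S k) (u s) : ℂ))
      (c * inner ℂ (S k) (u t) - inner ℂ k (u t)) (Icc 0 T) t := by
  have hd {t : ℝ} (ht : 0 < t) : HasDerivAt (fun s => (inner ℂ (S k) (u s) : ℂ))
      (c * inner ℂ (S k) (u t) - inner ℂ k (u t)) t := by
    have h1 : HasDerivAt u (deriv u t) t :=
      ((hu t ht).differentiableAt (Ioi_mem_nhds ht)).hasDerivAt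
    have h2 := (hasDerivAt_const t (S k)).inner ℂ h1
    refine h2.congr_deriv ?_
    have h3 : inner ℂ k (u t) = inner ℂ k (S (-deriv u t + c • u t)) := by rw [heq t ht]
    rw [h3, ← hS.inner_left_eq_inner_right, inner_add_right, inner_neg_right,
      inner_smul_right_eq_smul, inner_zero_left, Complex.real_smul]
    ring
  -- At t = 0 the orbit u itself need not be differentiable, but the derivative of ⟨S k, u⟩ has a
  -- limit as t ↓ 0, which is then the one-sided derivative.
  rcases ht.1.eq_or_lt with rfl | ht0
  · have hcont : ContinuousOn (fun s => (inner ℂ (S k) (u s) : ℂ)) (Icc 0 T) :=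
      ContinuousOn.inner (𝕜 := ℂ) continuousOn_const hc
    have hcont2 : ContinuousOn (fun s => (inner ℂ k (u s) : ℂ)) (Icc 0 T) :=
      ContinuousOn.inner (𝕜 := ℂ) continuousOn_const hc
    have hmem : Ioo 0 T ∈ 𝓝[>] (0 : ℝ) := Ioo_mem_nhdsGT hT
    have h0 : (0 : ℝ) ∈ Icc 0 T := ⟨le_rfl, hT.le⟩
    refine (hasDerivWithinAt_Ici_of_tendsto_deriv (s := Ioo 0 T)
      (fun s hs => (hd hs.1).differentiableAt.differentiableWithinAt)
      ((hcont 0 h0).mono Ioo_subset_Icc_self) hmem ?_).mono Icc_subset_Ici_self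
    have hlim : Tendsto (fun s => (c * inner ℂ (S k) (u s) - inner ℂ k (u s) : ℂ)) (𝓝[>] 0)
        (𝓝 (c * inner ℂ (S k) (u 0) - inner ℂ k (u 0))) := by
      have h1 : ContinuousWithinAt (fun s => (c * inner ℂ (S k) (u s) - inner ℂ k (u s) : ℂ))
          (Icc 0 T) 0 := ((continuousOn_const.mul hcont).sub hcont2) 0 h0
      have h2 := (h1.mono Ioo_subset_Icc_self).tendsto
      rwa [nhdsWithin_Ioo_eq_nhdsGT hT] at h2
    refine hlim.congr' ?_
    filter_upwards [self_mem_nhdsWithin] with s hs using (hd hs).deriv.symm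
  · exact (hd ht0).hasDerivWithinAt

/-- Weak solutions of `v' + S⁻¹ v = c v` satisfy `(S v)' = c S v - v`. -/
theorem hasDerivAt_of_weak [CompleteSpace H] {S : H →L[ℂ] H} (hS : S.IsPositive) {c T : ℝ}
    {v : ℝ → H} (hc : ContinuousOn v (Icc 0 T))
    (heq : ∀ k : H, ∀ t ∈ Icc 0 T, HasDerivWithinAt (fun s => (inner ℂ (S k) (v s) : ℂ))
      (c * inner ℂ (S k) (v t) - inner ℂ k (v t)) (Icc 0 T) t) {t : ℝ} (ht : t ∈ Ioo 0 T) :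
    HasDerivAt (fun s => S (v s)) (c • S (v t) - v t) t := by
  have hSv : ContinuousOn (fun s => S (v s)) (Icc 0 T) := S.continuous.comp_continuousOn hc
  refine hasDerivAt_of_inner (g := fun t => c • S (v t) - v t) ((hSv.const_smul c).sub hc) hSv
    (fun k s hs => ?_) ht
  have h := (heq k s (Ioo_subset_Icc_self hs)).hasDerivAt (Icc_mem_nhds hs.1 hs.2)
  -- Moving S to the other side makes `k` an arbitrary test vector for S v.
  simp only [hS.inner_left_eq_inner_right] at h
  refine h.congr_deriv ?_
  rw [inner_sub_right, inner_smul_right_eq_smul, Complex.real_smul]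

end AbstractCauchyProblem

/-! ### The potential as a bounded symmetric operator -/

section Potential

variable {G : Type*} [MeasurableSpace G] {μ : Measure G}

/-- Multiplication by a bounded real potential on `L²`. -/
noncomputable def potential (V : Lp ℝ ∞ μ) : Lp ℂ 2 μ →L[ℂ] Lp ℂ 2 μ :=
  LinearMap.mkContinuous
    { toFun := fun f => (V • f : Lp ℂ 2 μ)
      map_add' := fun f g => Lp.add_smul V f g
      map_smul' := fun c f => Lp.ext <| by
        filter_upwards [Lp.coeFn_lpSMul (r := 2) V (c • f), Lp.coeFn_smul c f,
          Lp.coeFn_smul c (V • f : Lp ℂ 2 μ), Lp.coeFn_lpSMul (r := 2) V f] with x h1 h2 h3 h4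
        rw [h1, RingHom.id_apply, h3, Pi.smul_apply', Pi.smul_apply, h2, h4, Pi.smul_apply,
          Pi.smul_apply', smul_comm] } ‖V‖ fun f => Lp.norm_smul_le V f

theorem potential_apply (V : Lp ℝ ∞ μ) (f : Lp ℂ 2 μ) : potential V f = (V • f : Lp ℂ 2 μ) := rfl

theorem inner_potential (V : Lp ℝ ∞ μ) (f g : Lp ℂ 2 μ) :
    inner ℂ (potential V f) g = inner ℂ f (potential V g) := by
  rw [L2.inner_def, L2.inner_def]
  refine integral_congr_ae ?_
  filter_upwards [Lp.coeFn_lpSMul (r := 2) V f, Lp.coeFn_lpSMul (r := 2) V g] with x h1 h2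
  rw [potential_apply, potential_apply, h1, h2]
  simp only [Pi.smul_apply', inner_smul_left_eq_smul, inner_smul_right_eq_smul]

end Potential

/-! ### Test functions inside L² -/

section TestFunctionsL2

variable {E : Type*} [NormedAddCommGroup E] [NormedSpace ℝ E]
  {G : Type*} [TopologicalSpace G] [ChartedSpace E G]
  [MeasurableSpace G] [BorelSpace G] {μ : Measure G} [IsFiniteMeasureOnCompacts μ]

theorem IsTestFunction.memLp {φ : G → ℂ} (h : IsTestFunction E φ) : MemLp φ 2 μ :=
  h.1.continuous.memLp_of_hasCompactSupport h.2

variable (E μ) in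
/-- The inclusion of the test functions into `L²`. -/
noncomputable def testToL2 : testFunctions E G →ₗ[ℂ] Lp ℂ 2 μ where
  toFun φ := (φ.2.memLp (μ := μ)).toLp φ
  map_add' φ ψ := MemLp.toLp_add φ.2.memLp ψ.2.memLp
  map_smul' c φ := MemLp.toLp_const_smul c φ.2.memLp

theorem coeFn_testToL2 (φ : testFunctions E G) : testToL2 E μ φ =ᵐ[μ] φ :=
  MemLp.coeFn_toLp (φ.2.memLp (μ := μ))

theorem inner_testToL2 (φ : testFunctions E G) (f : Lp ℂ 2 μ) :
    inner ℂ (testToL2 E μ φ) f = ∫ x, conj ((φ : G → ℂ) x) * f x ∂μ := by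
  rw [L2.inner_def]
  refine integral_congr_ae ?_
  filter_upwards [coeFn_testToL2 (μ := μ) φ] with x hx
  rw [hx, RCLike.inner_apply, mul_comm]

theorem inner_testToL2_testToL2 (φ ψ : testFunctions E G) :
    inner ℂ (testToL2 E μ φ) (testToL2 E μ ψ) =
      ∫ x, (ψ : G → ℂ) x * conj ((φ : G → ℂ) x) ∂μ := by
  rw [inner_testToL2]
  refine integral_congr_ae ?_
  filter_upwards [coeFn_testToL2 (μ := μ) ψ] with x hx
  rw [hx, mul_comm]

/-- An L² function is locally integrable, and vanishes a.e. once it is orthogonal to all real smooth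
compactly supported functions. -/
theorem denseRange_testToL2 [FiniteDimensional ℝ E] [IsManifold 𝓘(ℝ, E) ∞ G] [T2Space G]
    [SecondCountableTopology G] : DenseRange (testToL2 E μ) := by
  have : LocallyCompactSpace G := ChartedSpace.locallyCompactSpace E G
  have h : (testToL2 E μ).range.topologicalClosure = ⊤ := by
    rw [Submodule.topologicalClosure_eq_top_iff, Submodule.eq_bot_iff]
    intro f hf
    refine Lp.eq_zero_iff_ae_eq_zero.2 ?_
    refine ae_eq_zero_of_integral_contMDiff_smul_eq_zero 𝓘(ℝ, E)
      ((Lp.memLp f).locallyIntegrable one_le_two) fun g hg hgs => ?_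
    have hφ : IsTestFunction E fun x => (g x : ℂ) :=
      ⟨Complex.ofRealCLM.contMDiff.comp hg, hgs.comp_left Complex.ofReal_zero⟩
    have h0 := Submodule.inner_right_of_mem_orthogonal
      (LinearMap.mem_range_self (testToL2 E μ) ⟨_, hφ⟩) hf
    rw [inner_testToL2] at h0
    simpa using h0
  exact Submodule.dense_iff_topologicalClosure_eq_top.2 h

theorem tendsto_testToL2_iff {φ : ℕ → testFunctions E G} {f : Lp ℂ 2 μ} :
    Tendsto (fun k => testToL2 E μ (φ k)) atTop (𝓝 f) ↔
      Tendsto (fun k => eLpNorm (fun x => (φ k : G → ℂ) x - f x) 2 μ) atTop (𝓝 0) := by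
  rw [Lp.tendsto_Lp_iff_tendsto_eLpNorm']
  refine tendsto_congr fun k => eLpNorm_congr_ae ?_
  filter_upwards [coeFn_testToL2 (μ := μ) (φ k)] with x hx
  rw [Pi.sub_apply, hx]

end TestFunctionsL2

/-! ### The inverse of R + V + c -/

section Friedrichs

variable {E : Type*} [NormedAddCommGroup E] [NormedSpace ℝ E]
  {G : Type*} [TopologicalSpace G] [ChartedSpace E G] [Group G] [LieGroup 𝓘(ℝ, E) ∞ G]
  [MeasurableSpace G] [BorelSpace G] {μ : Measure G} [IsFiniteMeasureOnCompacts μ]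
  {gr : LieGrading E G} {R : HomogeneousOperator E G gr}

theorem inner_onTest_self (R : HomogeneousOperator E G gr) (φ : testFunctions E G) :
    inner ℂ (testToL2 E μ φ) (testToL2 E μ (R.onTest φ)) =
      ∫ x, R.apply φ x * conj ((φ : G → ℂ) x) ∂μ := by
  rw [inner_testToL2_testToL2, R.coe_onTest]

/-- A positive operator is symmetric. -/
theorem HomogeneousOperator.IsPositive.symm (hR : R.IsPositive μ) (φ ψ : testFunctions E G) :
    inner ℂ (testToL2 E μ (R.onTest φ)) (testToL2 E μ ψ) =
      inner ℂ (testToL2 E μ φ) (testToL2 E μ (R.onTest ψ)) := by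
  let B (φ ψ : testFunctions E G) : ℂ :=
    inner ℂ (testToL2 E μ φ) (testToL2 E μ (R.onTest ψ))
  have hB (φ : testFunctions E G) : (B φ φ).im = 0 := by
    simp only [B, inner_onTest_self]
    exact (hR φ φ.2).2
  -- Polarization: a sesquilinear form that is real on the diagonal is Hermitian, as seen at φ + ψ
  -- and φ + iψ.
  have h1 := hB (φ + ψ)
  have h2 := hB (φ + Complex.I • ψ)
  simp only [B, map_add, map_smul, inner_add_left, inner_add_right, inner_smul_left,
    inner_smul_right, Complex.add_im, Complex.add_re, Complex.mul_im, Complex.mul_re, Complex.I_re, Complex.I_im,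
    Complex.conj_I, Complex.neg_re, Complex.neg_im] at h1 h2
  have h3 := hB φ
  have h4 := hB ψ
  simp only [B] at h3 h4
  rw [← inner_conj_symm]
  apply Complex.ext
  · rw [Complex.conj_re]; linarith
  · rw [Complex.conj_im]; linarith

variable (R) in
/-- The operator `R + V + c` on test functions. -/
noncomputable def shiftedOperator (V : Lp ℝ ∞ μ) (c : ℝ) : testFunctions E G →ₗ[ℂ] Lp ℂ 2 μ :=
  testToL2 E μ ∘ₗ R.onTest +
    (potential V + (c : ℂ) • ContinuousLinearMap.id ℂ (Lp ℂ 2 μ)).toLinearMap ∘ₗ testToL2 E μ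

theorem shiftedOperator_apply (V : Lp ℝ ∞ μ) (c : ℝ) (φ : testFunctions E G) :
    shiftedOperator R V c φ = testToL2 E μ (R.onTest φ) +
      (potential V (testToL2 E μ φ) + (c : ℂ) • testToL2 E μ φ) := rfl

/-- Along an L²-convergent sequence the bounded part V + c contributes to the energy of differences
a term tending to 0. -/
theorem memFormDomain_shiftedOperator_iff (V : Lp ℝ ∞ μ) (c : ℝ) (f : Lp ℂ 2 μ) :
    MemFormDomain (testToL2 E μ) (shiftedOperator R V c) f ↔ R.MemSobolev f := by
  have key (φ : ℕ → testFunctions E G)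
      (hφ : Tendsto (fun k => testToL2 E μ (φ k)) atTop (𝓝 f)) :
      Tendsto (fun p : ℕ × ℕ => (inner ℂ (testToL2 E μ (φ p.1 - φ p.2))
        (shiftedOperator R V c (φ p.1 - φ p.2))).re) atTop (𝓝 0) ↔
      Tendsto (fun p : ℕ × ℕ => (∫ x, R.apply (φ p.1 - φ p.2 : testFunctions E G) x *
        conj (((φ p.1 - φ p.2 : testFunctions E G) : G → ℂ) x) ∂μ).re) atTop (𝓝 0) := by
    have hdiff : Tendsto (fun p : ℕ × ℕ => testToL2 E μ (φ p.1 - φ p.2)) atTop (𝓝 0) := by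
      simp only [map_sub]
      rw [← sub_self f, ← prod_atTop_atTop_eq]
      exact (hφ.comp tendsto_fst).sub (hφ.comp tendsto_snd)
    have hB : Tendsto (fun p : ℕ × ℕ => (inner ℂ (testToL2 E μ (φ p.1 - φ p.2))
        (potential V (testToL2 E μ (φ p.1 - φ p.2)) +
          (c : ℂ) • testToL2 E μ (φ p.1 - φ p.2)) : ℂ).re) atTop (𝓝 0) := by
      have hcont : Continuous fun x : Lp ℂ 2 μ =>
          (inner ℂ x (potential V x + (c : ℂ) • x) : ℂ).re := by fun_prop
      simpa only [inner_zero_left, Complex.zero_re, Function.comp_def] using (hcont.tendsto 0).comp hdiff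
    simp only [← inner_onTest_self, shiftedOperator_apply]
    simp only [inner_add_right (testToL2 E μ _) (testToL2 E μ (R.onTest _)), Complex.add_re]
    constructor <;> intro h
    · simpa using h.sub hB
    · simpa using h.add hB
  constructor
  · rintro ⟨φ, hφ, hE⟩
    exact ⟨fun k => φ k, fun k => (φ k).2, tendsto_testToL2_iff.1 hφ, (key φ hφ).1 hE⟩
  · rintro ⟨φ, ht, hφ, hE⟩
    let ψ : ℕ → testFunctions E G := fun k => ⟨φ k, ht k⟩
    have hψ := tendsto_testToL2_iff (φ := ψ).2 hφ
    exact ⟨ψ, hψ, (key ψ hψ).2 hE⟩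

/-- The inverse of the Friedrichs extension of `R + V + c`, where `c = ‖V‖ + 1`. -/
theorem exists_inverse [FiniteDimensional ℝ E] [T2Space G] [SecondCountableTopology G]
    (hR : R.IsPositive μ) (V : Lp ℝ ∞ μ) {c : ℝ} (hc : ‖V‖ + 1 ≤ c) :
    ∃ S : Lp ℂ 2 μ →L[ℂ] Lp ℂ 2 μ, S.IsPositive ∧ ‖S‖ ≤ 1 ∧ Function.Injective S ∧
      ∀ f g, R.HasValue f g ↔ S (g + V • f + c • f) = f := by
  have hlb (φ : testFunctions E G) : ‖testToL2 E μ φ‖ ^ 2 ≤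
      (inner ℂ (testToL2 E μ φ) (shiftedOperator R V c φ)).re := by
    set x := testToL2 E μ φ with hx
    have h1 : 0 ≤ (inner ℂ x (testToL2 E μ (R.onTest φ))).re := by
      rw [hx, inner_onTest_self]; exact (hR φ φ.2).1
    have h2 : -(‖V‖ * ‖x‖ ^ 2) ≤ (inner ℂ x (potential V x)).re := by
      have h3 : |(inner ℂ x (potential V x)).re| ≤ ‖x‖ * ‖potential V x‖ :=
        (Complex.abs_re_le_norm _).trans (norm_inner_le_norm _ _)
      have h4 : ‖potential V x‖ ≤ ‖V‖ * ‖x‖ := Lp.norm_smul_le V x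
      have h5 := mul_le_mul_of_nonneg_left h4 (norm_nonneg x)
      have h6 := (abs_le.1 h3).1
      nlinarith
    have h7 : (inner ℂ x ((c : ℂ) • x)).re = c * ‖x‖ ^ 2 := by
      rw [inner_smul_right, inner_self_eq_norm_sq_to_K, Complex.re_ofReal_mul]
      norm_cast
    rw [shiftedOperator_apply, inner_add_right, inner_add_right, Complex.add_re, Complex.add_re, h7]
    nlinarith [sq_nonneg ‖x‖]
  have hsymm (φ ψ : testFunctions E G) :
      inner ℂ (shiftedOperator R V c φ) (testToL2 E μ ψ) =
        inner ℂ (testToL2 E μ φ) (shiftedOperator R V c ψ) := by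
    simp only [shiftedOperator_apply, inner_add_left, inner_add_right, hR.symm, inner_potential,
      inner_smul_left, inner_smul_right, Complex.conj_ofReal]
  obtain ⟨S, hS, hS1, hinj, hval⟩ := exists_friedrichs_inverse (testToL2 E μ)
    (shiftedOperator R V c) denseRange_testToL2 hsymm hlb
  refine ⟨S, hS, hS1, hinj, fun f g => ?_⟩
  rw [hval, memFormDomain_shiftedOperator_iff]
  refine and_congr_right fun _ => ?_
  have hcf : c • f = (c : ℂ) • f := rfl
  -- Since V is symmetric and c real, their terms cancel from both sides, leaving R f = g tested
  -- against φ.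
  have key (φ : testFunctions E G) :
      inner ℂ (shiftedOperator R V c φ) f = inner ℂ (testToL2 E μ φ) (g + V • f + c • f) ↔
        ∫ x, conj (R.apply φ x) * f x ∂μ = ∫ x, conj ((φ : G → ℂ) x) * g x ∂μ := by
    rw [← inner_testToL2, ← R.coe_onTest, ← inner_testToL2, shiftedOperator_apply, hcf, add_assoc,
      ← potential_apply, inner_add_left, inner_add_right _ g, inner_add_left, inner_add_right,
      inner_potential, inner_smul_left, inner_smul_right, Complex.conj_ofReal, add_left_inj]
  exact ⟨fun h φ => (key φ).2 (h φ φ.2), fun h φ hφ => (key ⟨φ, hφ⟩).1 (h ⟨φ, hφ⟩)⟩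

end Friedrichs

/-! ### Both notions of solution give the same equation for S v -/

section CauchyProblem

/-- The two forms of the right-hand side of the weak equation. -/
theorem inner_weak_equation {G : Type*} [MeasurableSpace G] {μ : Measure G} {V : Lp ℝ ∞ μ}
    {c : ℝ} (w g x : Lp ℂ 2 μ) :
    -(inner ℂ g x) - inner ℂ w (V • x : Lp ℂ 2 μ) =
      (c * inner ℂ w x - inner ℂ (g + V • w + c • w) x : ℂ) := by
  have h : c • w = (c : ℂ) • w := rfl
  rw [h, inner_add_left, inner_add_left, inner_smul_left, Complex.conj_ofReal, ← potential_apply,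
    ← potential_apply, inner_potential]
  ring

variable {E : Type*} [NormedAddCommGroup E] [NormedSpace ℝ E]
  {G : Type*} [TopologicalSpace G] [ChartedSpace E G] [Group G]
  [MeasurableSpace G] {μ : Measure G} {gr : LieGrading E G} {R : HomogeneousOperator E G gr}
  {V : Lp ℝ ∞ μ} {u₀ : Lp ℂ 2 μ} {T c : ℝ} {S : Lp ℂ 2 μ →L[ℂ] Lp ℂ 2 μ}

/-- The V terms cancel, so the equation reads S (c v - v') = v, and the bounded S commutes with
d/dt. -/
theorem IsClassicalSolution.hasDerivAt_inverse
    (hval : ∀ f g, R.HasValue f g ↔ S (g + V • f + c • f) = f) {v : ℝ → Lp ℂ 2 μ}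
    (hv : IsClassicalSolution R V u₀ T v) {t : ℝ} (ht : t ∈ Ioo 0 T) :
    HasDerivAt (fun s => S (v s)) (c • S (v t) - v t) t := by
  have ht' : t ∈ Ioc 0 T := Ioo_subset_Ioc_self ht
  have h1 : HasDerivAt v (derivWithin v (Ioc 0 T) t) t :=
    ((hv.contDiffOn.differentiableOn one_ne_zero) t ht').hasDerivWithinAt.hasDerivAt
      (Ioc_mem_nhds ht.1 ht.2)
  have h2 := (hval _ _).1 (hv.equation t ht')
  rw [sub_add_cancel, map_add, map_neg] at h2
  have h3 : S (c • v t) = c • S (v t) := map_smul (S.restrictScalars ℝ) c (v t)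
  rw [h3] at h2
  have h4 : S (derivWithin v (Ioc 0 T) t) = c • S (v t) - v t :=
    eq_sub_of_add_eq (by rw [← eq_neg_add_iff_add_eq]; exact h2.symm)
  exact ((S.restrictScalars ℝ).hasFDerivAt.comp_hasDerivAt t h1).congr_deriv h4

/-- Testing with w = S k, for which R w = k - V w - c w, puts the weak equation in a form where k is
arbitrary. -/
theorem IsWeakSolution.hasDerivAt_inverse (hS : S.IsPositive)
    (hval : ∀ f g, R.HasValue f g ↔ S (g + V • f + c • f) = f) {v : ℝ → Lp ℂ 2 μ}
    (hv : IsWeakSolution R V u₀ T v) {t : ℝ} (ht : t ∈ Ioo 0 T) :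
    HasDerivAt (fun s => S (v s)) (c • S (v t) - v t) t := by
  refine hasDerivAt_of_weak hS hv.continuousOn (fun k t ht => ?_) ht
  have hk : (k - V • S k - c • S k) + V • S k + c • S k = k := by abel
  have h := hv.equation (S k) (k - V • S k - c • S k) ((hval _ _).2 (by rw [hk])) t ht
  rwa [inner_weak_equation (c := c), hk] at h

end CauchyProblem

end RocklandHeat

theorem mainTheorem10
    {E : Type*} [NormedAddCommGroup E] [NormedSpace ℝ E] [FiniteDimensional ℝ E]
    {G : Type*} [TopologicalSpace G] [ChartedSpace E G] [Group G] [LieGroup 𝓘(ℝ, E) ∞ G]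
    [T2Space G] [SecondCountableTopology G] [SimplyConnectedSpace G]
    [MeasurableSpace G] [BorelSpace G] (μ : Measure G) [μ.IsHaarMeasure]
    (gr : RocklandHeat.LieGrading E G) (R : RocklandHeat.HomogeneousOperator E G gr)
    (hRockland : R.IsRockland) (hPositive : R.IsPositive μ)
    (T : ℝ) (hT : 0 < T) (V : Lp ℝ ∞ μ) (u₀ : Lp ℂ 2 μ) :
    ∃ u : ℝ → Lp ℂ 2 μ,
      RocklandHeat.IsClassicalSolution R V u₀ T u ∧
      RocklandHeat.IsWeakSolution R V u₀ T u ∧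
      (∀ t ∈ Icc 0 T, ‖u t‖ ≤ Real.exp (t * ‖V‖) * ‖u₀‖) ∧
      ∀ v : ℝ → Lp ℂ 2 μ,
        RocklandHeat.IsClassicalSolution R V u₀ T v ∨ RocklandHeat.IsWeakSolution R V u₀ T v →
        EqOn v u (Icc 0 T) := by
  -- The smallest admissible shift, c = ‖V‖ + 1, makes the growth rate c - 1 exactly ‖V‖.
  obtain ⟨S, hS, hS1, hinj, hval⟩ := RocklandHeat.exists_inverse hPositive V le_rfl
  obtain ⟨u, hu0, huc, hun, hu1, hueq⟩ :=
    RocklandHeat.exists_classical_solution hS hS1 hinj (‖V‖ + 1) u₀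
  have hcont : ContinuousOn u (Icc 0 T) := huc.mono Icc_subset_Ici_self
  have hdiff : DifferentiableOn ℝ u (Ioi 0) := hu1.differentiableOn one_ne_zero
  have hclass : RocklandHeat.IsClassicalSolution R V u₀ T u := by
    refine ⟨hcont, hu0, hu1.mono fun t ht => ht.1, fun t ht => ?_⟩
    have hd : derivWithin u (Ioc 0 T) t = deriv u t :=
      ((hdiff t ht.1).differentiableAt (Ioi_mem_nhds ht.1)).derivWithin (uniqueDiffOn_Ioc 0 T t ht)
    rw [hval, hd, sub_add_cancel]
    exact hueq t ht.1
  refine ⟨u, hclass, ⟨hcont, hu0, fun w g hwg t ht => ?_⟩, fun t ht => ?_, fun v hv => ?_⟩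
  · rw [RocklandHeat.inner_weak_equation (c := ‖V‖ + 1)]
    have hw := (hval w g).1 hwg
    have h := RocklandHeat.hasDerivWithinAt_inner hS hT hcont hdiff hueq
      (g + V • w + (‖V‖ + 1) • w) ht
    rwa [hw] at h
  · simpa using hun t ht.1
  · have hvc : ContinuousOn v (Icc 0 T) := hv.elim (·.continuousOn) (·.continuousOn)
    have hv0 : v 0 = u₀ := hv.elim (·.initial) (·.initial)
    exact RocklandHeat.eqOn_of_hasDerivAt (c := ‖V‖ + 1) hS hinj hvc hcont (hv0.trans hu0.symm)
      (fun t ht => hv.elim (·.hasDerivAt_inverse hval ht) (·.hasDerivAt_inverse hS hval ht))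
      fun t ht => hclass.hasDerivAt_inverse hval ht
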